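/- Let $\mathcal R=\{z\in\mathbb C:\operatorname{Re}z>0\}$, let $\overline{\mathcal R}$ be its closure, and let $\operatorname{Hol}(\overline{\mathcal R})$ be the set of functions holomorphic in a neighbourhood of $\overline{\mathcal R}$. For $0<b<\infty$ let $S_b=\{z:0<\operatorname{Re}z<b\}$, and let $H^2(S_b)$ be the space of holomorphic functions $f$ on $S_b$ with $\sup_{0<x<b}\int_{-\infty}^{+\infty}|f(x+iy)|^2\,dy<\infty$. Let $\mathcal M^2$ be the space of holomorphic functions $f$ on $\mathcal R$ such that $f\in H^2(S_b)$ for every $b>0$ and $$\sum_{n=0}^{\infty}\frac{2^n}{n!}\int_{-\infty}^{+\infty}\left|f\left(\tfrac n2+iy\right)\right|^2dy<\infty,$$ where $f$ on the imaginary axis means the boundary values, that is, the limit of $f(x+i\,\cdot)$ in $L^2(\mathbb R)$ as $x\to0^+$. Put $\mathcal M^2(\overline{\mathcal R})=\mathcal M^2\cap\operatorname{Hol}(\overline{\mathcal R})$. For $\tau\in\mathbb R$ let $\mathcal E_\tau(\overline{\mathcal R})$ be the space of $f\in\operatorname{Hol}(\overline{\mathcal R})$ of exponential type (at most) $\tau$,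 that is, such that for every $\varepsilon>0$ there is a constant $C$ with $|f(z)|\le Ce^{(\tau+\varepsilon)|z|}$ for all $z\in\overline{\mathcal R}$, and let $\mathcal E_{<\tau}(\overline{\mathcal R})=\bigcup_{\sigma<\tau}\mathcal E_\sigma(\overline{\mathcal R})$. For a family $\mathcal K\subseteq\operatorname{Hol}(\overline{\mathcal R})$ let $\mathcal Z(\mathcal K)$ be the collection of the zero sets in $\overline{\mathcal R}$, counted with multiplicity, of the functions in $\mathcal K$ that do not vanish identically. Then $$\mathcal Z\big(\mathcal E_{<\frac\pi2}(\overline{\mathcal R})\big)\subseteq\mathcal Z\big(\mathcal M^2(\overline{\mathcal R})\big)\subseteq\mathcal Z\big(\mathcal E_{\frac\pi2}(\overline{\mathcal R})\big).$$ -/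

import Mathlib

open MeasureTheory Filter Topology

noncomputable section

namespace HalfPlane

/-- The open right half-plane. -/
def openRHP : Set ℂ := {z | 0 < z.re}

/-- The closed right half-plane. -/
def closedRHP : Set ℂ := {z | 0 ≤ z.re}

/-- The functions holomorphic on (a neighbourhood of) the closed right half-plane.
Values off that neighbourhood play no role. -/
def holClosed : Set (ℂ → ℂ) := {f | AnalyticOnNhd ℂ f closedRHP}

/-- The point `x + i y`. -/
def pt (x y : ℝ) : ℂ := (x : ℂ) + (y : ℂ) * Complex.I

/-- The Hardy space `H²(S_b)` of the vertical strip `S_b = {0 < Re z < b}`. -/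
def hardyStrip (b : ℝ) : Set (ℂ → ℂ) :=
  {f | DifferentiableOn ℂ f {z | 0 < z.re ∧ z.re < b} ∧
    (⨆ x ∈ Set.Ioo (0 : ℝ) b, ∫⁻ y : ℝ, ‖f (pt x y)‖ₑ ^ 2) < ⊤}

/-- The measure `ω = ∑ₙ (2ⁿ / n!) δ_{n/2}(x) ⊗ dy`, carried by the closed right half-plane. -/
def omega : Measure ℂ :=
  Measure.sum fun n : ℕ =>
    ENNReal.ofReal ((2 : ℝ) ^ n / (n.factorial : ℝ)) •
      Measure.map (fun y : ℝ => pt ((n : ℝ) / 2) y) volume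

/-- The values of `f` on the imaginary axis are its boundary values: `f(x + i·) → f(0 + i·)`
in `L²(ℝ)` as `x → 0⁺`. -/
def HasBoundaryValues (f : ℂ → ℂ) : Prop :=
  Tendsto (fun x : ℝ => eLpNorm (fun y : ℝ => f (pt x y) - f (pt 0 y)) 2 volume)
    (𝓝[>] (0 : ℝ)) (𝓝 0)

/-- The space `M²_ω(R)`: functions holomorphic on the open right half-plane, in `H²(S_b)` for
every `b > 0` and in `L²(ω)`, where `f` on the imaginary axis (a set of positive `ω`-measure)
means the boundary values of `f`. -/
def M2 : Set (ℂ → ℂ) :=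
  {f | DifferentiableOn ℂ f openRHP ∧ (∀ b : ℝ, 0 < b → f ∈ hardyStrip b) ∧
    HasBoundaryValues f ∧ MemLp f 2 omega}

/-- Holomorphic functions on the closed right half-plane of exponential type (at most) `τ`. -/
def expType (τ : ℝ) : Set (ℂ → ℂ) :=
  {f | f ∈ holClosed ∧ ∀ ε : ℝ, 0 < ε →
    ∃ C : ℝ, ∀ z ∈ closedRHP, ‖f z‖ ≤ C * Real.exp ((τ + ε) * ‖z‖)}

/-- Holomorphic functions on the closed right half-plane of exponential type less than `τ`. -/
def expTypeLT (τ : ℝ) : Set (ℂ → ℂ) := {f | ∃ σ : ℝ, σ < τ ∧ f ∈ expType σ}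

/-- The zero sets of a family `K` of functions holomorphic on the closed right half-plane, each
zero counted with its multiplicity. A zero set is recorded by its multiplicity function
`m : ℂ → ℕ`, which is zero off the closed half-plane and at the points that are not zeros. The
zero sets are those of the functions in `K` that do not vanish identically. -/
def zeroSets (K : Set (ℂ → ℂ)) : Set (ℂ → ℕ) :=
  {m | ∃ f ∈ K, (∃ z ∈ closedRHP, f z ≠ 0) ∧
    (∀ z ∈ closedRHP, analyticOrderAt f z = (m z : ℕ∞)) ∧ ∀ z ∉ closedRHP, m z = 0}

end HalfPlane

end

noncomputable section

namespace HalfPlane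

/-! Multiplication by a zero-free function `exp E`, with `E` holomorphic on the closed half-plane,
keeps zero sets (`zeroSets_subset_of_mul_exp`), so each inclusion reduces to choosing `E`. The main
ingredient is z log(1+z), with real part x log|1+z| - y arg(1+z). Here y arg(1+z) equals π/2 |y| up
to O(1+x), and e^{x log x} is, up to exponential factors e^{O(x)}, the growth that the weights 2ⁿ/n!
allow on the lines x = n/2.

If g has type σ < π/2, then g exp(z log(1+z) - Az) decays like e^{-δ|y|} on vertical lines, because
the surplus π/2 - σ beats g. For large A its growth in x is slow enough for the weighted sum
(`mem_M2_of_norm_le`).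

Conversely, let f be in M². A Cauchy estimate from L² norms on two vertical lines (`pi_mul_norm_le`)
gives |f| ≤ C(1+x)x^x for x ≥ 1 and |f| ≤ K/x for 0 < x ≤ 1, so exp(-z log(1+z)) brings f down to
type π/2 away from the axis. On the axis f is only known to be in L² and may be unbounded. This is
repaired by a further factor exp(-H) with Re H ≥ 0 throughout and Re H ≥ |f|² - 1 on the axis
(`exists_re_dominating`). A maximum principle on boxes (`norm_le_near_axis`) then bounds f exp(-H)
for 0 ≤ x ≤ 1. -/

/-! ### Vertical lines and the measure ω. -/

@[simp] lemma pt_re (x y : ℝ) : (pt x y).re = x := by simp [pt]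

@[simp] lemma pt_im (x y : ℝ) : (pt x y).im = y := by simp [pt]

lemma pt_re_im (z : ℂ) : pt z.re z.im = z := Complex.re_add_im z

lemma continuous_pt : Continuous fun p : ℝ × ℝ => pt p.1 p.2 := by
  unfold pt; fun_prop

lemma continuous_pt_right (x : ℝ) : Continuous (pt x) :=
  continuous_pt.comp (Continuous.prodMk_right x)

lemma measurableEmbedding_pt (x : ℝ) : MeasurableEmbedding fun y : ℝ => pt x y := by
  have h : Topology.IsClosedEmbedding fun y : ℝ => pt x y := by
    refine Topology.IsClosedEmbedding.of_continuous_injective_isClosedMap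
      (continuous_pt_right x) (fun a b h => by simpa using congrArg Complex.im h) ?_
    intro s hs
    have : (fun y : ℝ => pt x y) '' s = {z : ℂ | z.re = x} ∩ Complex.im ⁻¹' s := by
      ext z
      constructor
      · rintro ⟨y, hy, rfl⟩; simpa using hy
      · rintro ⟨h1, h2⟩
        refine ⟨z.im, h2, ?_⟩
        have h1 : z.re = x := h1
        simp only [← h1]
        exact pt_re_im z
    rw [this]
    exact (isClosed_eq Complex.continuous_re continuous_const).inter
      (hs.preimage Complex.continuous_im)
  exact h.measurableEmbedding

lemma openRHP_subset_closedRHP : openRHP ⊆ closedRHP := fun z (h : 0 < z.re) => h.le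

lemma pt_mem_closedRHP {x : ℝ} (hx : 0 ≤ x) (y : ℝ) : pt x y ∈ closedRHP := by
  simpa [closedRHP] using hx

/-- Multiplying every function of a family by a suitable zero-free one preserves zero sets. -/
lemma zeroSets_subset_of_mul_exp {K L : Set (ℂ → ℂ)} (hK : K ⊆ holClosed)
    (h : ∀ f ∈ K, ∃ E : ℂ → ℂ, AnalyticOnNhd ℂ E closedRHP ∧
      (fun z => f z * Complex.exp (E z)) ∈ L) : zeroSets K ⊆ zeroSets L := by
  rintro m ⟨f, hf, ⟨z, hz, hfz⟩, hm, hm0⟩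
  obtain ⟨E, hE, hL⟩ := h f hf
  refine ⟨_, hL, ⟨z, hz, mul_ne_zero hfz (Complex.exp_ne_zero _)⟩, fun w hw => ?_, hm0⟩
  have hexp : AnalyticAt ℂ (fun z => Complex.exp (E z)) w := (hE w hw).cexp
  have := analyticOrderAt_mul (hK hf w hw) hexp
  rw [hexp.analyticOrderAt_eq_zero.2 (Complex.exp_ne_zero _), add_zero, hm w hw] at this
  exact this

lemma lintegral_omega (F : ℂ → ENNReal) :
    ∫⁻ z, F z ∂omega = ∑' n : ℕ, ENNReal.ofReal ((2 : ℝ) ^ n / (n.factorial : ℝ)) *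
      ∫⁻ y : ℝ, F (pt ((n : ℝ) / 2) y) := by
  simp only [omega, lintegral_sum_measure, lintegral_smul_measure, smul_eq_mul]
  congr! 3 with n
  exact (measurableEmbedding_pt _).lintegral_map _

lemma memLp_omega_iff {f : ℂ → ℂ} (hf : ContinuousOn f closedRHP) :
    MemLp f 2 omega ↔ (∑' n : ℕ, ENNReal.ofReal ((2 : ℝ) ^ n / (n.factorial : ℝ)) *
      ∫⁻ y : ℝ, ‖f (pt ((n : ℝ) / 2) y)‖ₑ ^ 2) < ⊤ := by
  have hm : AEStronglyMeasurable f omega := by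
    rw [omega, aestronglyMeasurable_sum_measure_iff]
    intro n
    refine AEStronglyMeasurable.smul_measure ?_ _
    rw [(measurableEmbedding_pt _).aestronglyMeasurable_map_iff]
    refine Continuous.aestronglyMeasurable ?_
    exact hf.comp_continuous (continuous_pt_right _)
      fun y => pt_mem_closedRHP (by positivity) y
  rw [← lintegral_omega fun z => ‖f z‖ₑ ^ 2, MemLp, and_iff_right hm,
    eLpNorm_lt_top_iff_lintegral_rpow_enorm_lt_top (by norm_num) (by norm_num)]
  norm_num

/-! ### A pointwise criterion for membership in M². -/

lemma integrable_exp_neg_mul_abs {δ : ℝ} (hδ : 0 < δ) :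
    Integrable fun y : ℝ => Real.exp (-(δ * |y|)) := by
  rw [← integrableOn_univ, ← Set.Iic_union_Ioi (a := (0 : ℝ))]
  refine IntegrableOn.union ?_ ?_
  · refine (integrableOn_exp_mul_Iic hδ 0).congr_fun (fun y hy => ?_) measurableSet_Iic
    have hy : y ≤ 0 := hy
    simp [abs_of_nonpos hy]
  · refine (integrableOn_exp_mul_Ioi (neg_lt_zero.2 hδ) 0).congr_fun (fun y hy => ?_)
      measurableSet_Ioi
    have hy : 0 < y := hy
    simp [abs_of_pos hy]

/-- The exponential is the square of e^{x log(1+x) - 2x} at x = n/2. Since (n+2)ⁿ/n! ≤ e^{n+2}, the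
factor e^{-2n} leaves the geometric bound e^{2-n}. -/
lemma summable_weights : Summable fun n : ℕ => (2 : ℝ) ^ n / (n.factorial : ℝ) *
    Real.exp (n * Real.log (1 + n / 2) - 2 * n) := by
  have hs : Summable fun n : ℕ => Real.exp 2 * Real.exp (-1 * n) :=
    ((Real.summable_exp_nat_mul_iff.2 (by norm_num : (-1 : ℝ) < 0)).congr
      fun n => by rw [mul_comm]).mul_left _
  refine Summable.of_nonneg_of_le (fun n => by positivity) (fun n => ?_) hs
  have h1 : (0 : ℝ) < 1 + n / 2 := by positivity
  have h2 : Real.exp (n * Real.log (1 + n / 2) - 2 * n) =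
      (1 + n / 2 : ℝ) ^ n * Real.exp (-2 * n) := by
    rw [sub_eq_add_neg, Real.exp_add, Real.exp_nat_mul, Real.exp_log h1]
    congr 2; ring
  have h3 := Real.pow_div_factorial_le_exp (n + 2 : ℝ) (by positivity) n
  calc _ = ((n + 2 : ℝ) ^ n / n.factorial) * Real.exp (-2 * n) := by
        rw [h2, show (n + 2 : ℝ) = 2 * (1 + n / 2) by ring, mul_pow]; ring
    _ ≤ Real.exp (n + 2) * Real.exp (-2 * n) := by gcongr
    _ = _ := by rw [← Real.exp_add, ← Real.exp_add]; congr 1; ring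

/-- Membership in `M2` from a pointwise bound. -/
lemma mem_M2_of_norm_le {f : ℂ → ℂ} (hf : f ∈ holClosed) {C δ : ℝ} (hδ : 0 < δ)
    (hb : ∀ x : ℝ, 0 ≤ x → ∀ y : ℝ,
      ‖f (pt x y)‖ ≤ C * Real.exp (x * Real.log (1 + x) - 2 * x - δ * |y|)) : f ∈ M2 := by
  have hC : 0 ≤ C := by
    have := (norm_nonneg _).trans (hb 0 le_rfl 0)
    simpa using this
  have hcont : ContinuousOn f closedRHP := hf.continuousOn
  have hint : Integrable fun y : ℝ => Real.exp (-(2 * δ * |y|)) :=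
    integrable_exp_neg_mul_abs (by positivity)
  set I : ENNReal := ∫⁻ y : ℝ, ENNReal.ofReal (Real.exp (-(2 * δ * |y|))) with hI
  have hItop : I < ⊤ := hint.lintegral_lt_top
  have hline : ∀ x : ℝ, 0 ≤ x → ∫⁻ y : ℝ, ‖f (pt x y)‖ₑ ^ 2 ≤
      ENNReal.ofReal (C ^ 2 * Real.exp (2 * x * Real.log (1 + x) - 4 * x)) * I := by
    intro x hx
    rw [hI, ← lintegral_const_mul _ (by fun_prop)]
    refine lintegral_mono fun y => ?_
    rw [← ofReal_norm, ← ENNReal.ofReal_pow (norm_nonneg _),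
      ← ENNReal.ofReal_mul (by positivity)]
    refine ENNReal.ofReal_le_ofReal ?_
    calc ‖f (pt x y)‖ ^ 2
        ≤ (C * Real.exp (x * Real.log (1 + x) - 2 * x - δ * |y|)) ^ 2 := by
          gcongr; exact hb x hx y
      _ = _ := by
          rw [mul_pow, ← Real.exp_nat_mul, mul_assoc, ← Real.exp_add]
          congr 2; push_cast; ring
  refine ⟨hf.differentiableOn.mono openRHP_subset_closedRHP, fun b hb0 => ⟨?_, ?_⟩, ?_, ?_⟩
  · exact hf.differentiableOn.mono fun z hz => le_of_lt hz.1
  · refine lt_of_le_of_lt (b := ENNReal.ofReal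
      (C ^ 2 * Real.exp (2 * b * Real.log (1 + b))) * I) ?_
      (ENNReal.mul_lt_top ENNReal.ofReal_lt_top hItop)
    refine iSup₂_le fun x hx => (hline x hx.1.le).trans ?_
    have := hx.1
    gcongr
    have h1 : Real.log (1 + x) ≤ Real.log (1 + b) :=
      Real.log_le_log (by linarith) (by linarith [hx.2])
    have h2 : 0 ≤ Real.log (1 + x) := Real.log_nonneg (by linarith)
    have h3 : 2 * x * Real.log (1 + x) ≤ 2 * b * Real.log (1 + b) := by
      gcongr; exact hx.2.le
    linarith
  -- Dominated convergence: for 0 < x < 1 the growth factor is at most e^{log 2}, and continuity up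
  -- to the axis gives the pointwise limit.
  · set B : ℝ := C * Real.exp (Real.log 2) + C with hB
    have hb1 : ∀ x ∈ Set.Ioo (0 : ℝ) 1, ∀ y, ‖f (pt x y) - f (pt 0 y)‖ ≤
        B * Real.exp (-(δ * |y|)) := by
      intro x hx y
      have h0 := hb 0 le_rfl y
      have h1 := hb x hx.1.le y
      have h2 : x * Real.log (1 + x) ≤ Real.log 2 := by
        have : Real.log (1 + x) ≤ Real.log 2 := Real.log_le_log (by linarith [hx.1])
          (by linarith [hx.2])
        have h4 : 0 ≤ Real.log (1 + x) := Real.log_nonneg (by linarith [hx.1])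
        nlinarith [hx.1, hx.2]
      have h3 : ‖f (pt x y)‖ ≤ C * Real.exp (Real.log 2 + -(δ * |y|)) := by
        refine h1.trans ?_
        gcongr
        linarith [hx.1]
      rw [Real.exp_add] at h3
      have h0' : ‖f (pt 0 y)‖ ≤ C * Real.exp (-(δ * |y|)) := by
        simpa using h0
      calc _ ≤ ‖f (pt x y)‖ + ‖f (pt 0 y)‖ := norm_sub_le _ _
        _ ≤ _ := by rw [hB]; linarith
    have hlim : Tendsto (fun x : ℝ => ∫⁻ y : ℝ, ‖f (pt x y) - f (pt 0 y)‖ₑ ^ 2)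
        (𝓝[>] (0 : ℝ)) (𝓝 (∫⁻ _ : ℝ, 0)) := by
      refine tendsto_lintegral_filter_of_dominated_convergence
        (fun y => ENNReal.ofReal (B ^ 2 * Real.exp (-(2 * δ * |y|)))) ?_ ?_ ?_ ?_
      · filter_upwards [self_mem_nhdsWithin] with x hx
        have h1 : Continuous fun y => f (pt x y) := hcont.comp_continuous
          (continuous_pt_right _) fun y => pt_mem_closedRHP (le_of_lt hx) y
        have h2 : Continuous fun y => f (pt 0 y) := hcont.comp_continuous
          (continuous_pt_right _) fun y => pt_mem_closedRHP le_rfl y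
        exact (h1.sub h2).enorm.measurable.pow_const 2
      · filter_upwards [Ioo_mem_nhdsGT (zero_lt_one' ℝ)] with x hx
        refine ae_of_all _ fun y => ?_
        rw [← ofReal_norm, ← ENNReal.ofReal_pow (norm_nonneg _)]
        refine ENNReal.ofReal_le_ofReal ?_
        calc _ ≤ (B * Real.exp (-(δ * |y|))) ^ 2 := by gcongr; exact hb1 x hx y
          _ = _ := by
            rw [mul_pow, ← Real.exp_nat_mul]; congr 2; push_cast; ring
      · exact (hint.const_mul (B ^ 2)).lintegral_lt_top.ne
      · refine ae_of_all _ fun y => ?_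
        have h1 : ContinuousAt f (pt 0 y) := (hf _ (pt_mem_closedRHP le_rfl y)).continuousAt
        have h2 : Tendsto (fun x : ℝ => f (pt x y) - f (pt 0 y)) (𝓝 0)
            (𝓝 (f (pt 0 y) - f (pt 0 y))) := by
          refine Tendsto.sub_const ?_ _
          refine h1.tendsto.comp ?_
          exact (continuous_pt.comp (Continuous.prodMk_left y)).tendsto 0
        have h3 := ((ENNReal.continuous_pow 2).tendsto _).comp h2.enorm
        simp only [sub_self, enorm_zero, ne_eq, OfNat.ofNat_ne_zero, not_false_eq_true,
          zero_pow] at h3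
        exact h3.mono_left nhdsWithin_le_nhds
    rw [lintegral_zero] at hlim
    have h4 := ((ENNReal.continuous_rpow_const (y := (1 / 2 : ℝ))).tendsto 0).comp hlim
    rw [ENNReal.zero_rpow_of_pos (by norm_num)] at h4
    refine h4.congr fun x => ?_
    rw [eLpNorm_eq_lintegral_rpow_enorm_toReal (by norm_num) (by norm_num)]
    simp
  · rw [memLp_omega_iff hcont]
    have hs := (summable_weights.mul_left (C ^ 2))
    calc _ ≤ ∑' n : ℕ, ENNReal.ofReal (C ^ 2 * ((2 : ℝ) ^ n / (n.factorial : ℝ) *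
          Real.exp (n * Real.log (1 + n / 2) - 2 * n))) * I := by
          refine ENNReal.tsum_le_tsum fun n => ?_
          calc _ ≤ _ := mul_le_mul_right (hline (n / 2) (by positivity)) _
            _ = _ := by
              rw [← mul_assoc, ← ENNReal.ofReal_mul (by positivity)]
              congr 2
              rw [show 2 * ((n : ℝ) / 2) = n by ring, show 4 * ((n : ℝ) / 2) = 2 * n by ring]
              ring
      _ < ⊤ := by
        rw [ENNReal.tsum_mul_right]
        refine ENNReal.mul_lt_top ?_ hItop
        rw [← ENNReal.ofReal_tsum_of_nonneg (fun n => by positivity) hs]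
        exact ENNReal.ofReal_lt_top

/-! ### The size of exp(z log(1+z)) and the first inclusion. -/

lemma one_add_mem_slitPlane {z : ℂ} (hz : z ∈ closedRHP) : 1 + z ∈ Complex.slitPlane := by
  left
  have : 0 ≤ z.re := hz
  simp only [Complex.add_re, Complex.one_re]
  linarith

lemma analyticOnNhd_mul_log : AnalyticOnNhd ℂ (fun z => z * Complex.log (1 + z)) closedRHP :=
  fun _ hz => analyticAt_id.mul ((analyticAt_const.add analyticAt_id).clog
    (one_add_mem_slitPlane hz))

lemma re_mul_log (z : ℂ) : (z * Complex.log (1 + z)).re =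
    z.re * Real.log ‖1 + z‖ - z.im * Complex.arg (1 + z) := by
  rw [Complex.mul_re, Complex.log_re, Complex.log_im]

lemma im_mul_arg (w : ℂ) : w.im * Complex.arg w = |w.im| * |Complex.arg w| := by
  rcases le_or_gt 0 w.im with h | h
  · rw [abs_of_nonneg h, abs_of_nonneg (Complex.arg_nonneg_iff.2 h)]
  · rw [abs_of_neg h, abs_of_neg (Complex.arg_neg_iff.2 h)]; ring

lemma im_mul_arg_le {w : ℂ} (hw : 0 ≤ w.re) : w.im * Complex.arg w ≤ Real.pi / 2 * |w.im| := by
  rw [im_mul_arg, mul_comm]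
  gcongr
  exact Complex.abs_arg_le_pi_div_two_iff.2 hw

/-- With t = π/2 - |arg w| one has Re w = |w| sin t and |Im w| = |w| cos t, so t ≤ tan t says t |Im
w| ≤ Re w. -/
lemma le_im_mul_arg {w : ℂ} (hw : 0 < w.re) :
    Real.pi / 2 * |w.im| - w.re ≤ w.im * Complex.arg w := by
  rw [im_mul_arg]
  have hn : 0 < ‖w‖ := norm_pos_iff.2 fun h => by simp [h] at hw
  set t := Real.pi / 2 - |Complex.arg w| with ht
  have h1 : |Complex.arg w| < Real.pi / 2 := Complex.abs_arg_lt_pi_div_two_iff.2 (Or.inl hw)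
  have hs : ‖w‖ * Real.sin t = w.re := by
    rw [ht, Real.sin_pi_div_two_sub, Real.cos_abs, Complex.norm_mul_cos_arg]
  have hc : ‖w‖ * Real.cos t = |w.im| := by
    rw [ht, Real.cos_pi_div_two_sub, ← Complex.norm_mul_sin_arg w, abs_mul, abs_norm]
    congr 1
    rcases le_or_gt 0 (Complex.arg w) with h | h
    · rw [abs_of_nonneg h, abs_of_nonneg
        (Real.sin_nonneg_of_nonneg_of_le_pi h (Complex.arg_le_pi w))]
    · rw [abs_of_neg h, Real.sin_neg, abs_of_nonpos
        (Real.sin_nonpos_of_nonpos_of_neg_pi_le h.le (Complex.neg_pi_lt_arg w).le)]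
  have key : t * Real.cos t ≤ Real.sin t := by
    have h0 : 0 ≤ t := by linarith
    rcases eq_or_lt_of_le (abs_nonneg (Complex.arg w)) with h | h
    · have : t = Real.pi / 2 := by rw [ht, ← h, sub_zero]
      rw [this]; simp
    · have h5 : t < Real.pi / 2 := by linarith
      have h6 := Real.le_tan h0 h5
      rw [Real.tan_eq_sin_div_cos] at h6
      have h7 : 0 < Real.cos t := Real.cos_pos_of_mem_Ioo ⟨by linarith [Real.pi_pos], h5⟩
      rwa [le_div_iff₀ h7] at h6
  have : t * |w.im| ≤ w.re := by
    rw [← hs, ← hc]; nlinarith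
  rw [ht] at this
  linarith

/-- Applying log s ≤ s - 1 at s = δ(1+u), with u = v/(1+x), makes the slope in v as small as
desired. The price is a multiple of x, which a factor e^{-Az} can absorb. -/
lemma mul_log_one_add_add_le {x v δ : ℝ} (hx : 0 ≤ x) (hv : 0 ≤ v) (hδ : 0 < δ) :
    x * Real.log (1 + x + v) ≤
      x * Real.log (1 + x) + δ * v + |δ - 1 - Real.log δ| * x := by
  have h1 : (0 : ℝ) < 1 + x := by linarith
  set u := v / (1 + x) with hu
  have hu0 : 0 ≤ u := by positivity
  have e : 1 + x + v = (1 + x) * (1 + u) := by rw [hu]; field_simp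
  have h2 : Real.log (1 + u) ≤ δ * (1 + u) - 1 - Real.log δ := by
    have := Real.log_le_sub_one_of_pos (x := δ * (1 + u)) (by positivity)
    rw [Real.log_mul hδ.ne' (by positivity)] at this
    linarith
  have h3 : x * u ≤ v := by
    rw [hu, mul_div_assoc', div_le_iff₀ h1]; nlinarith
  rw [e, Real.log_mul h1.ne' (by positivity)]
  have h4 : x * Real.log (1 + u) ≤ x * (δ * (1 + u) - 1 - Real.log δ) := by gcongr
  have h5 : x * (δ - 1 - Real.log δ) ≤ x * |δ - 1 - Real.log δ| := by
    gcongr; exact le_abs_self _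
  nlinarith

theorem zeroSets_expTypeLT_subset :
    zeroSets (expTypeLT (Real.pi / 2)) ⊆ zeroSets (M2 ∩ holClosed) := by
  refine zeroSets_subset_of_mul_exp (fun f ⟨σ, _, h⟩ => h.1) ?_
  rintro g ⟨σ, hσ, hg, hgb⟩
  obtain ⟨C, hC⟩ := hgb ((Real.pi / 2 - σ) / 2) (by linarith)
  -- The maximum with 0 covers negative σ: the bound ‖z‖ ≤ x + |y| needs a nonnegative coefficient.
  set s := max (σ + (Real.pi / 2 - σ) / 2) 0 with hs
  have hs0 : 0 ≤ s := le_max_right _ _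
  have hs1 : s < Real.pi / 2 := max_lt (by linarith) (by positivity)
  have hC0 : 0 ≤ C := by
    have := (norm_nonneg _).trans (hC 0 (by simp [closedRHP]))
    simpa using this
  -- Half of the surplus π/2 - s = 2δ pays for |y| inside log|1+z|; the other half is the decay
  -- e^{-δ|y|}.
  set δ := (Real.pi / 2 - s) / 2 with hδ
  have hδ0 : 0 < δ := by rw [hδ]; linarith
  -- The terms s and |δ - 1 - log δ| cancel the linear growth in x from g and from the logarithm. Of
  -- the 3, one cancels the error in the argument estimate and two give the required -2x.
  set A : ℝ := s + |δ - 1 - Real.log δ| + 3 with hA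
  have hE : AnalyticOnNhd ℂ (fun z => z * Complex.log (1 + z) - A * z) closedRHP :=
    analyticOnNhd_mul_log.sub (analyticOnNhd_const.mul analyticOnNhd_id)
  have hf : (fun z => g z * Complex.exp (z * Complex.log (1 + z) - A * z)) ∈ holClosed :=
    hg.mul hE.cexp
  refine ⟨_, hE, mem_M2_of_norm_le hf hδ0 (C := C * Real.exp 1) fun x hx y => ?_, hf⟩
  have hz := pt_mem_closedRHP hx y
  have hnz : ‖pt x y‖ ≤ x + |y| := by
    have := Complex.norm_le_abs_re_add_abs_im (pt x y)
    simpa [abs_of_nonneg hx] using this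
  have h1 : ‖g (pt x y)‖ ≤ C * Real.exp (s * (x + |y|)) := by
    refine (hC _ hz).trans ?_
    gcongr
    exact le_max_left _ _
  have hn : ‖1 + pt x y‖ ≤ 1 + x + |y| := by
    have := norm_add_le (1 : ℂ) (pt x y)
    rw [norm_one] at this
    linarith
  have hlog : x * Real.log ‖1 + pt x y‖ ≤ x * Real.log (1 + x + |y|) := by
    gcongr
    exact norm_pos_iff.2 (Complex.slitPlane_ne_zero (one_add_mem_slitPlane hz))
  have h2 := mul_log_one_add_add_le hx (abs_nonneg y) hδ0
  have h3 := le_im_mul_arg (w := 1 + pt x y) (by simp; linarith)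
  simp only [Complex.add_im, Complex.one_im, pt_im, zero_add, Complex.add_re, Complex.one_re,
    pt_re] at h3
  have hre : (pt x y * Complex.log (1 + pt x y) - A * pt x y).re =
      x * Real.log ‖1 + pt x y‖ - y * Complex.arg (1 + pt x y) - A * x := by
    rw [Complex.sub_re, re_mul_log]
    simp
  rw [norm_mul, Complex.norm_exp, hre]
  calc _ ≤ C * Real.exp (s * (x + |y|)) *
        Real.exp (x * Real.log ‖1 + pt x y‖ - y * Complex.arg (1 + pt x y) - A * x) := by gcongr
    _ = C * Real.exp (s * (x + |y|) +
        (x * Real.log ‖1 + pt x y‖ - y * Complex.arg (1 + pt x y) - A * x)) := by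
        rw [mul_assoc, ← Real.exp_add]
    _ ≤ C * Real.exp (1 + (x * Real.log (1 + x) - 2 * x - δ * |y|)) := by
        refine mul_le_mul_of_nonneg_left (Real.exp_le_exp.2 ?_) hC0
        have : Real.pi / 2 = s + 2 * δ := by rw [hδ]; ring
        rw [this] at h3
        rw [hA]
        nlinarith
    _ = _ := by rw [Real.exp_add]; ring

/-! ### Dominating the boundary values by the real part of a holomorphic function. -/

lemma re_inv_sub_nonneg {z p : ℂ} (hz : 0 ≤ z.re) (hp : p.re ≤ 0) : 0 ≤ ((z - p)⁻¹).re := by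
  rw [Complex.inv_re]
  exact div_nonneg (by rw [Complex.sub_re]; linarith) (Complex.normSq_nonneg _)

/-- A combination of Cauchy kernels with poles at height in `[a, a + 1]` whose real part dominates
`u - 1` on that segment of the imaginary axis. -/
lemma exists_kernel_sum {u : ℝ → ℝ} (hu : Continuous u) (hu0 : ∀ t, 0 ≤ u t) (a : ℝ) :
    ∃ (F : ℂ → ℂ) (δ : ℝ), 0 < δ ∧
      (∀ z ∈ closedRHP, 0 ≤ (F z).re) ∧
      (∀ y ∈ Set.Icc a (a + 1), u y - 1 ≤ (F (pt 0 y)).re) ∧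
      (∀ z d, 0 < d → (d ≤ z.re + δ ∨ d ≤ |z.im - a| - 1) →
        DifferentiableAt ℂ F z ∧ ‖F z‖ ≤ 2 * (∫ t in a..a + 1, u t) / d) := by
  have huc := (isCompact_Icc (a := a) (b := a + 1)).uniformContinuousOn_of_continuous
    hu.continuousOn
  rw [Metric.uniformContinuousOn_iff] at huc
  obtain ⟨η, hη, huη⟩ := huc 1 one_pos
  obtain ⟨N, hN⟩ := exists_nat_one_div_lt hη
  -- One δ is both the mesh of the grid and the distance of the poles to the left of the axis. Hence
  -- on its own cell each kernel has real part δ/(δ² + (y-t)²) ≥ 1/(2δ).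
  set δ : ℝ := 1 / (N + 1 : ℝ) with hδ
  have hδ0 : 0 < δ := by positivity
  have hNδ : (N + 1 : ℝ) * δ = 1 := by rw [hδ]; field_simp
  set t : ℕ → ℝ := fun i => a + i * δ with ht
  have hts : ∀ i, t (i + 1) = t i + δ := fun i => by simp only [ht]; push_cast; ring
  -- The 2 compensates for the 2 in 1/(2δ): the term of a cell then dominates the average of u
  -- there, which is at least u(y) - 1 because the oscillation on a cell is below 1.
  set c : ℕ → ℝ := fun i => 2 * ∫ s in t i..t (i + 1), u s with hc
  have hc0 : ∀ i, 0 ≤ c i := fun i => mul_nonneg zero_le_two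
    (intervalIntegral.integral_nonneg (by rw [hts]; linarith) fun s _ => hu0 s)
  set p : ℕ → ℂ := fun i => pt (-δ) (t i) with hp
  have htmem : ∀ i < N + 1, t i ∈ Set.Icc a (a + 1) ∧ t i + δ ≤ a + 1 := by
    intro i hi
    have h1 : ((i : ℝ) + 1) ≤ N + 1 := by exact_mod_cast hi
    have h2 : ((i : ℝ) + 1) * δ ≤ (N + 1) * δ := by gcongr
    have h3 : 0 ≤ (i : ℝ) * δ := by positivity
    simp only [ht, Set.mem_Icc]
    refine ⟨⟨by linarith, by linarith⟩, by linarith⟩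
  have hsum : ∑ i ∈ Finset.range (N + 1), c i = 2 * ∫ s in a..a + 1, u s := by
    rw [hc, ← Finset.mul_sum, intervalIntegral.sum_integral_adjacent_intervals
      fun k _ => hu.intervalIntegrable _ _]
    have h0 : t 0 = a := by simp [ht]
    have h1 : t (N + 1) = a + 1 := by simp only [ht]; push_cast; rw [hNδ]
    rw [h0, h1]
  refine ⟨fun z => ∑ i ∈ Finset.range (N + 1), (c i : ℂ) * (z - p i)⁻¹, δ, hδ0, ?_, ?_, ?_⟩
  · intro z hz
    rw [Complex.re_sum]
    refine Finset.sum_nonneg fun i _ => ?_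
    rw [Complex.re_ofReal_mul]
    exact mul_nonneg (hc0 i) (re_inv_sub_nonneg hz (by simp [hp, hδ0.le]))
  · intro y hy
    obtain ⟨i, hi, hy1, hy2⟩ : ∃ i < N + 1, t i ≤ y ∧ y ≤ t i + δ := by
      -- The right endpoint is put in the last cell, since the floor would give the index N + 1.
      rcases eq_or_lt_of_le hy.2 with h | h
      · refine ⟨N, Nat.lt_succ_self N, ?_, ?_⟩
        · exact (htmem N (Nat.lt_succ_self N)).1.2.trans h.ge
        · simp only [ht]; linarith
      · have h0 : 0 ≤ (y - a) * (N + 1) := mul_nonneg (by linarith [hy.1]) (by positivity)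
        have hf1 := Nat.floor_le h0
        have hf2 := Nat.lt_floor_add_one ((y - a) * (N + 1))
        have e : (y - a) * (N + 1) * δ = y - a := by rw [mul_assoc, hNδ, mul_one]
        refine ⟨⌊(y - a) * (N + 1)⌋₊, ?_, ?_, ?_⟩
        · rw [Nat.floor_lt h0]
          push_cast
          have : (y - a) * (N + 1) < 1 * (N + 1) := by gcongr; linarith
          linarith
        · have := mul_le_mul_of_nonneg_right hf1 hδ0.le
          simp only [ht]; linarith
        · have := mul_le_mul_of_nonneg_right hf2.le hδ0.le
          simp only [ht]; linarith
    have hterm : u y - 1 ≤ c i * ((pt 0 y - p i)⁻¹).re := by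
      have hre : (pt 0 y - p i).re = δ := by simp [hp]
      have him : (pt 0 y - p i).im = y - t i := by simp [hp]
      rw [Complex.inv_re, Complex.normSq_apply, hre, him]
      have hden : δ * δ + (y - t i) * (y - t i) ≤ 2 * δ ^ 2 := by nlinarith
      have h1 : (2 * δ)⁻¹ ≤ δ / (δ * δ + (y - t i) * (y - t i)) := by
        rw [le_div_iff₀ (by nlinarith [mul_self_nonneg (y - t i)]), inv_mul_le_iff₀ (by positivity)]
        nlinarith
      have h2 : δ * (u y - 1) ≤ ∫ s in t i..t (i + 1), u s := by
        have : ∫ s in t i..t (i + 1), (u y - 1) ≤ ∫ s in t i..t (i + 1), u s := by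
          refine intervalIntegral.integral_mono_on (by rw [hts]; linarith) (by simp)
            (hu.intervalIntegrable _ _) fun s hs => ?_
          rw [hts] at hs
          obtain ⟨⟨h3, h4⟩, h5⟩ := htmem i hi
          have := huη y hy s ⟨by linarith [hs.1], by linarith [hs.2]⟩ (by
            rw [Real.dist_eq, abs_lt]; constructor <;> linarith [hs.1, hs.2])
          rw [Real.dist_eq, abs_lt] at this
          linarith [this.2]
        rwa [intervalIntegral.integral_const, hts, add_sub_cancel_left, smul_eq_mul,
          ← hts] at this
      calc u y - 1 = 2 * (δ * (u y - 1)) * (2 * δ)⁻¹ := by field_simp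
        _ ≤ c i * (2 * δ)⁻¹ := by
            simp only [hc]; gcongr
        _ ≤ _ := by gcongr; exact hc0 i
    rw [Complex.re_sum]
    refine hterm.trans ?_
    rw [← Complex.re_ofReal_mul]
    refine Finset.single_le_sum (f := fun i => ((c i : ℂ) * (pt 0 y - p i)⁻¹).re)
      (fun j _ => ?_) (Finset.mem_range.2 hi)
    rw [Complex.re_ofReal_mul]
    exact mul_nonneg (hc0 j) (re_inv_sub_nonneg (by simp) (by simp [hp, hδ0.le]))
  · intro z d hd hz
    have hdist : ∀ i < N + 1, d ≤ ‖z - p i‖ := by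
      intro i hi
      rcases hz with h | h
      · refine h.trans (le_trans ?_ (Complex.re_le_norm _))
        simp [hp]
      · refine le_trans ?_ (Complex.abs_im_le_norm _)
        obtain ⟨⟨h3, h4⟩, -⟩ := htmem i hi
        have : (z - p i).im = (z.im - a) - (t i - a) := by simp [hp]
        rw [this]
        have h6 := abs_sub_abs_le_abs_sub (z.im - a) (t i - a)
        rw [abs_of_nonneg (by linarith : 0 ≤ t i - a)] at h6
        linarith
    constructor
    · refine DifferentiableAt.fun_sum fun i hi => ?_
      have h1 : z - p i ≠ 0 := norm_pos_iff.1 (hd.trans_le (hdist i (Finset.mem_range.1 hi)))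
      have h2 : DifferentiableAt ℂ (fun w => (w - p i)⁻¹) z :=
        DifferentiableAt.fun_inv (by fun_prop) h1
      exact h2.const_mul _
    · rw [← hsum, Finset.sum_div]
      refine norm_sum_le_of_le _ fun i hi => ?_
      rw [norm_mul, norm_inv, Complex.norm_real, Real.norm_of_nonneg (hc0 i), div_eq_mul_inv]
      gcongr
      · exact hc0 i
      · exact hdist i (Finset.mem_range.1 hi)

/-- An integrable continuous function on the imaginary axis is dominated, up to a constant, by the
real part of a function holomorphic on the closed half-plane with nonnegative real part. -/
lemma exists_re_dominating {u : ℝ → ℝ} (hu : Continuous u) (hu0 : ∀ t, 0 ≤ u t)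
    (hi : Integrable u) :
    ∃ H : ℂ → ℂ, AnalyticOnNhd ℂ H closedRHP ∧ (∀ z ∈ closedRHP, 0 ≤ (H z).re) ∧
      ∀ y : ℝ, u y - 1 ≤ (H (pt 0 y)).re := by
  choose F δ hδ hre hdom hbd using fun k : ℤ => exists_kernel_sum hu hu0 (k : ℝ)
  have hsm : Summable fun k : ℤ => 2 * ∫ t in (k : ℝ)..k + 1, u t := by
    have := (hi.hasSum_intervalIntegral 0).summable.mul_left 2
    simpa using this
  -- The offsets δ k may tend to 0 with k. Near z₀, however, only finitely many k have poles at a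
  -- nearby height; all others are separated from z₀ vertically.
  have hloc : ∀ z₀ ∈ closedRHP, ∃ d : ℝ, 0 < d ∧ ∀ k, ∀ z ∈ Metric.ball z₀ d,
      DifferentiableAt ℂ (F k) z ∧ ‖F k z‖ ≤ 2 * (∫ t in (k : ℝ)..k + 1, u t) / d := by
    intro z₀ hz₀
    have hev : ∀ᶠ d : ℝ in 𝓝[>] 0, ∀ k ∈ Finset.Icc ⌊z₀.im - 3⌋ ⌈z₀.im + 3⌉, d ≤ δ k / 2 := by
      rw [Finset.eventually_all]
      intro k _
      exact (eventually_le_nhds (half_pos (hδ k))).filter_mono nhdsWithin_le_nhds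
    obtain ⟨d, hd, hd1⟩ := (hev.and (Ioo_mem_nhdsGT (zero_lt_one' ℝ))).exists
    refine ⟨d, hd1.1, fun k z hz => hbd k z d hd1.1 ?_⟩
    rw [Metric.mem_ball, dist_eq_norm] at hz
    have hre' := (Complex.abs_re_le_norm (z - z₀)).trans_lt hz
    have him' := (Complex.abs_im_le_norm (z - z₀)).trans_lt hz
    rw [Complex.sub_re, abs_lt] at hre'
    rw [Complex.sub_im, abs_lt] at him'
    by_cases hk : k ∈ Finset.Icc ⌊z₀.im - 3⌋ ⌈z₀.im + 3⌉
    · left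
      have := hd k hk
      have h0 : 0 ≤ z₀.re := hz₀
      linarith [hre'.1]
    · right
      rw [Finset.mem_Icc, not_and_or, not_le, not_le, Int.lt_floor_iff, Int.ceil_lt_iff] at hk
      rcases hk with hk | hk
      · have := le_abs_self (z.im - k)
        linarith [hd1.2]
      · have := neg_le_abs (z.im - k)
        linarith [hd1.2]
  have hsum : ∀ z ∈ closedRHP, Summable fun k => F k z := by
    intro z hz
    obtain ⟨d, hd, h⟩ := hloc z hz
    exact Summable.of_norm_bounded (hsm.div_const d)
      fun k => (h k z (Metric.mem_ball_self hd)).2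
  have hnn : ∀ z ∈ closedRHP, HasSum (fun k => (F k z).re) (∑' k, F k z).re :=
    fun z hz => Complex.hasSum_re (hsum z hz).hasSum
  refine ⟨fun z => ∑' k, F k z, fun z₀ hz₀ => ?_, fun z hz => ?_, fun y => ?_⟩
  · obtain ⟨d, hd, h⟩ := hloc z₀ hz₀
    have : DifferentiableOn ℂ (fun z => ∑' k, F k z) (Metric.ball z₀ d) :=
      Complex.differentiableOn_tsum_of_summable_norm (hsm.div_const d)
        (fun k z hz => (h k z hz).1.differentiableWithinAt) Metric.isOpen_ball
        fun k z hz => (h k z hz).2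
    exact this.analyticAt (Metric.ball_mem_nhds z₀ hd)
  · exact (hnn z hz).nonneg fun k => hre k z hz
  · have hz := pt_mem_closedRHP le_rfl y
    refine (hdom ⌊y⌋ y ⟨Int.floor_le y, (Int.lt_floor_add_one y).le⟩).trans ?_
    exact le_hasSum (hnn _ hz) ⌊y⌋ fun k _ => hre k _ hz

/-! ### A Cauchy estimate from L² norms on vertical lines. -/

lemma integral_norm_sq_le_of_lintegral {h : ℝ → ℂ} {a b B : ℝ} (hab : a ≤ b)
    (hc : ContinuousOn h (Set.Icc a b)) (hB : 0 ≤ B)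
    (hl : ∫⁻ x in Set.Icc a b, ‖h x‖ₑ ^ 2 ≤ ENNReal.ofReal B) :
    ∫ x in a..b, ‖h x‖ ^ 2 ≤ B := by
  rw [intervalIntegral.integral_of_le hab, ← integral_Icc_eq_integral_Ioc,
    integral_eq_lintegral_of_nonneg_ae (ae_of_all _ fun x => by positivity)
      (ContinuousOn.aestronglyMeasurable (by fun_prop) measurableSet_Icc)]
  refine ENNReal.toReal_le_of_le_ofReal hB (le_trans (le_of_eq ?_) hl)
  refine lintegral_congr fun x => ?_
  rw [ENNReal.ofReal_pow (norm_nonneg _), ofReal_norm]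

/-- A weighted form of the Cauchy–Schwarz inequality. -/
lemma norm_integral_mul_le {h k : ℝ → ℂ} {a b B c : ℝ} (hab : a ≤ b)
    (hc : ContinuousOn h (Set.Icc a b)) (hk : ContinuousOn k (Set.Icc a b)) (hB : 0 ≤ B)
    (hl : ∫⁻ x in Set.Icc a b, ‖h x‖ₑ ^ 2 ≤ ENNReal.ofReal B) (hc0 : 0 < c) :
    ‖∫ x in a..b, h x * k x‖ ≤ (B / c + c * ∫ x in a..b, ‖k x‖ ^ 2) / 2 := by
  have hu : Set.uIcc a b = Set.Icc a b := Set.uIcc_of_le hab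
  have hi1 : IntervalIntegrable (fun x => ‖h x‖ ^ 2) volume a b :=
    ContinuousOn.intervalIntegrable (by rw [hu]; exact hc.norm.pow 2)
  have hi2 : IntervalIntegrable (fun x => ‖k x‖ ^ 2) volume a b :=
    ContinuousOn.intervalIntegrable (by rw [hu]; exact hk.norm.pow 2)
  have hi3 : IntervalIntegrable (fun x => (‖h x‖ ^ 2 / c + c * ‖k x‖ ^ 2) / 2) volume a b :=
    ((hi1.div_const c).add (hi2.const_mul c)).div_const 2
  -- The inequality 2|h||k| ≤ |h|²/c + c|k|², with c left free so that each side of a contour can be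
  -- balanced separately.
  calc _ ≤ ∫ x in a..b, (‖h x‖ ^ 2 / c + c * ‖k x‖ ^ 2) / 2 := by
        refine intervalIntegral.norm_integral_le_of_norm_le hab (ae_of_all _ fun x _ => ?_) hi3
        rw [norm_mul, le_div_iff₀ two_pos, div_add' _ _ _ hc0.ne', le_div_iff₀ hc0]
        nlinarith [sq_nonneg (‖h x‖ - c * ‖k x‖)]
    _ = ((∫ x in a..b, ‖h x‖ ^ 2) / c + c * ∫ x in a..b, ‖k x‖ ^ 2) / 2 := by
        rw [intervalIntegral.integral_div, intervalIntegral.integral_add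
          (hi1.div_const c) (hi2.const_mul c), intervalIntegral.integral_div,
          intervalIntegral.integral_const_mul]
    _ ≤ _ := by
        gcongr
        exact integral_norm_sq_le_of_lintegral hab hc hB hl

lemma integral_div_sq_add_sq (b s t : ℝ) (hb : b ≠ 0) :
    ∫ y in s..t, b / (b ^ 2 + y ^ 2) = Real.arctan (t / b) - Real.arctan (s / b) := by
  refine intervalIntegral.integral_eq_sub_of_hasDerivAt
    (f := fun y => Real.arctan (y / b)) (fun y _ => ?_) ?_
  · have h : HasDerivAt (fun y => Real.arctan (y / b)) (1 / (1 + (y / b) ^ 2) * (1 / b)) y :=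
      ((hasDerivAt_id y).div_const b).arctan
    have e : b / (b ^ 2 + y ^ 2) = 1 / (1 + (y / b) ^ 2) * (1 / b) := by field_simp
    rwa [e]
  · refine Continuous.intervalIntegrable ?_ _ _
    exact continuous_const.div (by fun_prop) fun y => by positivity

lemma integral_div_sq_add_sq_mem {b s t : ℝ} (hb : 0 < b) (hs : b ≤ s) (ht : b ≤ t) :
    Real.pi / 2 ≤ ∫ y in -s..t, b / (b ^ 2 + y ^ 2) ∧
      ∫ y in -s..t, b / (b ^ 2 + y ^ 2) ≤ Real.pi := by
  rw [integral_div_sq_add_sq b _ _ hb.ne', neg_div, Real.arctan_neg]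
  have h1 : Real.pi / 4 ≤ Real.arctan (s / b) := by
    rw [← Real.arctan_one]; exact Real.arctan_mono ((one_le_div hb).2 hs)
  have h2 : Real.pi / 4 ≤ Real.arctan (t / b) := by
    rw [← Real.arctan_one]; exact Real.arctan_mono ((one_le_div hb).2 ht)
  have h3 := Real.arctan_lt_pi_div_two (s / b)
  have h4 := Real.arctan_lt_pi_div_two (t / b)
  constructor <;> linarith

lemma pt_inv_re (x y : ℝ) : ((pt x y)⁻¹).re = x / (x ^ 2 + y ^ 2) := by
  rw [Complex.inv_re, Complex.normSq_apply, pt_re, pt_im, pow_two, pow_two]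

lemma pt_inv_im (x y : ℝ) : ((pt x y)⁻¹).im = -y / (x ^ 2 + y ^ 2) := by
  rw [Complex.inv_im, Complex.normSq_apply, pt_re, pt_im, pow_two, pow_two]

lemma norm_pt_inv_sq (x y : ℝ) : ‖(pt x y)⁻¹‖ ^ 2 = 1 / (x ^ 2 + y ^ 2) := by
  rw [norm_inv, inv_pow, ← Complex.normSq_eq_norm_sq, Complex.normSq_apply, pt_re, pt_im, one_div,
    pow_two, pow_two]

lemma pt_ne_zero {x y : ℝ} (h : x ≠ 0 ∨ y ≠ 0) : pt x y ≠ 0 := by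
  intro h0
  have h1 := congrArg Complex.re h0
  have h2 := congrArg Complex.im h0
  simp only [pt_re, pt_im, Complex.zero_re, Complex.zero_im] at h1 h2
  tauto

lemma continuous_pt_left (y : ℝ) : Continuous fun x => pt x y :=
  continuous_pt.comp (Continuous.prodMk_left y)

lemma re_integral {k : ℝ → ℂ} {a b : ℝ} (hk : IntervalIntegrable k volume a b) :
    (∫ t in a..b, k t).re = ∫ t in a..b, (k t).re :=
  (Complex.reCLM.intervalIntegral_comp_comm hk).symm

lemma im_integral {k : ℝ → ℂ} {a b : ℝ} (hk : IntervalIntegrable k volume a b) :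
    (∫ t in a..b, k t).im = ∫ t in a..b, (k t).im :=
  (Complex.imCLM.intervalIntegral_comp_comm hk).symm

/-- A function with finite integral is at most one arbitrarily far out in both directions. -/
lemma exists_le_one_of_lintegral_lt_top {h : ℝ → ENNReal} (hh : ∫⁻ y, h y < ⊤) (R : ℝ) :
    (∃ T, R ≤ T ∧ h T ≤ 1) ∧ ∃ T, R ≤ T ∧ h (-T) ≤ 1 := by
  constructor
  · by_contra! hc
    have : ∫⁻ _ in Set.Ici R, 1 ≤ ∫⁻ y, h y :=
      (setLIntegral_mono' measurableSet_Ici fun y hy => (hc y hy).le).trans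
        (setLIntegral_le_lintegral _ _)
    rw [setLIntegral_one, Real.volume_Ici] at this
    exact absurd hh (not_lt.2 this)
  · by_contra! hc
    have : ∫⁻ _ in Set.Iic (-R), 1 ≤ ∫⁻ y, h y := by
      refine (setLIntegral_mono' measurableSet_Iic fun y hy => ?_).trans
        (setLIntegral_le_lintegral _ _)
      have hy : y ≤ -R := hy
      have := (hc (-y) (by linarith)).le
      rwa [neg_neg] at this
    rw [setLIntegral_one, Real.volume_Iic] at this
    exact absurd hh (not_lt.2 this)

/-- Cauchy estimate at the origin in terms of the `L²` norms on two vertical lines. -/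
lemma pi_mul_norm_zero_le {f : ℂ → ℂ} {α β d A : ℝ} (hd : 0 < d) (hα : d ≤ -α) (hβ : d ≤ β)
    (hA : 0 < A) (hf : DifferentiableOn ℂ f {w | α ≤ w.re ∧ w.re ≤ β})
    (hL : ∫⁻ y, ‖f (pt α y)‖ₑ ^ 2 ≤ ENNReal.ofReal (A ^ 2))
    (hR : ∫⁻ y, ‖f (pt β y)‖ₑ ^ 2 ≤ ENNReal.ofReal (A ^ 2))
    (hfin : ∫⁻ x in Set.Icc α β, ∫⁻ y, ‖f (pt x y)‖ₑ ^ 2 < ⊤) :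
    Real.pi * ‖f 0‖ ≤ A * (1 + Real.pi / d) := by
  set S : Set ℂ := {w | α ≤ w.re ∧ w.re ≤ β} with hS
  have hαβ : α ≤ β := by linarith
  have hS0 : S ∈ 𝓝 (0 : ℂ) := by
    have : Complex.re ⁻¹' Set.Ioo α β ∈ 𝓝 (0 : ℂ) :=
      (isOpen_Ioo.preimage Complex.continuous_re).mem_nhds
        ⟨by simp only [Complex.zero_re]; linarith, by simp only [Complex.zero_re]; linarith⟩
    exact mem_of_superset this fun w hw => ⟨hw.1.le, hw.2.le⟩
  -- The slope (f(w) - f(0))/w has no pole, so Cauchy's theorem on a rectangle turns ∮ f(w)/w into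
  -- f(0) ∮ 1/w.
  have hds : DifferentiableOn ℂ (dslope f 0) S := (Complex.differentiableOn_dslope hS0).2 hf
  have hpath : ∀ (γ : ℝ → ℂ) (a b : ℝ), a ≤ b → Continuous γ →
      (∀ t ∈ Set.Icc a b, γ t ≠ 0 ∧ γ t ∈ S) →
      ContinuousOn (fun t => f (γ t)) (Set.Icc a b) ∧
      ContinuousOn (fun t => (γ t)⁻¹) (Set.Icc a b) ∧
      IntervalIntegrable (fun t => (γ t)⁻¹) volume a b ∧
      ∫ t in a..b, dslope f 0 (γ t) =
        (∫ t in a..b, f (γ t) * (γ t)⁻¹) - f 0 * ∫ t in a..b, (γ t)⁻¹ := by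
    intro γ a b hab hγ hm
    have hu : Set.uIcc a b = Set.Icc a b := Set.uIcc_of_le hab
    have h1 : ContinuousOn (fun t => f (γ t)) (Set.Icc a b) :=
      hf.continuousOn.comp hγ.continuousOn fun t ht => (hm t ht).2
    have h2 : ContinuousOn (fun t => (γ t)⁻¹) (Set.Icc a b) :=
      hγ.continuousOn.inv₀ fun t ht => (hm t ht).1
    have h3 : IntervalIntegrable (fun t => (γ t)⁻¹) volume a b :=
      ContinuousOn.intervalIntegrable (by rwa [hu])
    refine ⟨h1, h2, h3, ?_⟩
    rw [← intervalIntegral.integral_const_mul, ← intervalIntegral.integral_sub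
      (ContinuousOn.intervalIntegrable (by rw [hu]; exact h1.mul h2)) (h3.const_mul _)]
    refine intervalIntegral.integral_congr fun t ht => ?_
    rw [hu] at ht
    rw [dslope_of_ne _ (hm t ht).1, slope_def_field, sub_zero, div_eq_mul_inv, sub_mul]
  -- By Tonelli, the horizontal integrals of |f|² are integrable in the height, which yields
  -- arbitrarily high segments, above and below, where they are at most 1.
  have hswap : ∫⁻ y, ∫⁻ x in Set.Icc α β, ‖f (pt x y)‖ₑ ^ 2 < ⊤ := by
    rw [← lintegral_lintegral_swap]
    · exact hfin
    · have : (volume.restrict (Set.Icc α β)).prod (volume : Measure ℝ) =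
          (volume.prod volume).restrict (Set.Icc α β ×ˢ Set.univ) := by
        rw [← Measure.prod_restrict, Measure.restrict_univ]
      rw [this]
      have hc : ContinuousOn (fun q : ℝ × ℝ => f (pt q.1 q.2)) (Set.Icc α β ×ˢ Set.univ) :=
        hf.continuousOn.comp continuous_pt.continuousOn fun q hq => by
          simpa [hS] using hq
      exact (hc.enorm.aemeasurable (measurableSet_Icc.prod MeasurableSet.univ)).pow_const 2
  refine le_of_forall_pos_le_add fun η hη => ?_
  -- At height |s| ≥ R, weighted Cauchy–Schwarz with c = |s| bounds a horizontal side by (1 + (β -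
  -- α))/(2|s|) ≤ η/2. Also R exceeds both distances to the vertical lines.
  set R : ℝ := max (max (-α) β) ((1 + (β - α)) / η) with hRdef
  obtain ⟨⟨T, hT, hhT⟩, ⟨T', hT', hhT'⟩⟩ := exists_le_one_of_lintegral_lt_top hswap R
  have hR1 : -α ≤ R := (le_max_left _ _).trans (le_max_left _ _)
  have hR2 : β ≤ R := (le_max_right _ _).trans (le_max_left _ _)
  have hR3 : (1 + (β - α)) / η ≤ R := le_max_right _ _
  have hT0 : 0 < T := by linarith
  have hT0' : 0 < T' := by linarith
  have hTT : -T' ≤ T := by linarith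
  obtain ⟨cb, cb', ib, eb⟩ := hpath (fun x => pt x (-T')) α β hαβ (continuous_pt_left _)
    fun x hx => ⟨pt_ne_zero (Or.inr (by linarith)), by simpa [hS] using hx⟩
  obtain ⟨ct, ct', it, et⟩ := hpath (fun x => pt x T) α β hαβ (continuous_pt_left _)
    fun x hx => ⟨pt_ne_zero (Or.inr hT0.ne'), by simpa [hS] using hx⟩
  obtain ⟨cr, cr', ir, er⟩ := hpath (pt β) (-T') T hTT (continuous_pt_right _)
    fun x hx => ⟨pt_ne_zero (Or.inl (by linarith)), by simpa [hS] using hαβ⟩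
  obtain ⟨cl, cl', il, el⟩ := hpath (pt α) (-T') T hTT (continuous_pt_right _)
    fun x hx => ⟨pt_ne_zero (Or.inl (by linarith)), by simpa [hS] using hαβ⟩
  have hrect := Complex.integral_boundary_rect_eq_zero_of_differentiableOn (dslope f 0)
    (pt α (-T')) (pt β T) (hds.mono fun w hw => by
      have := hw.1
      simpa [Set.uIcc_of_le hαβ, hS] using this)
  simp only [pt_re, pt_im] at hrect
  change (∫ x in α..β, dslope f 0 (pt x (-T'))) - (∫ x in α..β, dslope f 0 (pt x T)) +
    Complex.I • (∫ y in -T'..T, dslope f 0 (pt β y)) -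
    Complex.I • (∫ y in -T'..T, dslope f 0 (pt α y)) = 0 at hrect
  rw [eb, et, er, el, smul_eq_mul, smul_eq_mul] at hrect
  have nside : ∀ s : ℝ, R ≤ |s| → ∫⁻ x in Set.Icc α β, ‖f (pt x s)‖ₑ ^ 2 ≤ 1 →
      ContinuousOn (fun x => f (pt x s)) (Set.Icc α β) →
      ContinuousOn (fun x => (pt x s)⁻¹) (Set.Icc α β) →
      ‖∫ x in α..β, f (pt x s) * (pt x s)⁻¹‖ ≤ η / 2 := by
    intro s hs h1 hc hc'
    have hs0 : 0 < |s| := by linarith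
    have h2 : ∫ x in α..β, ‖(pt x s)⁻¹‖ ^ 2 ≤ (β - α) * (1 / |s| ^ 2) := by
      have := intervalIntegral.integral_mono_on hαβ
        (ContinuousOn.intervalIntegrable (μ := volume) (u := fun x => ‖(pt x s)⁻¹‖ ^ 2)
          (by rw [Set.uIcc_of_le hαβ]; exact hc'.norm.pow 2))
        (intervalIntegrable_const (c := 1 / |s| ^ 2)) fun x _ => by
          rw [norm_pt_inv_sq, sq_abs]
          have : 0 < s ^ 2 := by rw [← sq_abs]; positivity
          gcongr
          nlinarith [sq_nonneg x]
      rwa [intervalIntegral.integral_const, smul_eq_mul] at this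
    refine (norm_integral_mul_le hαβ hc hc' zero_le_one (by simpa using h1) hs0).trans ?_
    have h3 : |s| * ∫ x in α..β, ‖(pt x s)⁻¹‖ ^ 2 ≤ (β - α) / |s| := by
      refine (mul_le_mul_of_nonneg_left h2 hs0.le).trans (le_of_eq ?_)
      field_simp
    have h4 : (1 + (β - α)) / |s| ≤ η := by
      rw [div_le_iff₀ hs0, ← div_le_iff₀' hη]
      exact hR3.trans hs
    rw [add_div] at h4
    linarith
  have nb := nside (-T') (by rwa [abs_neg, abs_of_pos hT0']) hhT' cb cb'
  have nt := nside T (by rwa [abs_of_pos hT0]) hhT ct ct'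
  have kv : ∀ b, d ≤ b → b ≤ R → ∫ y in -T'..T, 1 / (b ^ 2 + y ^ 2) ≤ Real.pi / d := by
    intro b hb hbR
    have hb0 : 0 < b := by linarith
    have h1 := (integral_div_sq_add_sq_mem hb0 (hbR.trans hT') (hbR.trans hT)).2
    calc _ = (∫ y in -T'..T, b / (b ^ 2 + y ^ 2)) / b := by
          rw [← intervalIntegral.integral_div]
          congr 1; ext y; field_simp
      _ ≤ Real.pi / b := by gcongr
      _ ≤ _ := by gcongr
  have nr : ‖∫ y in -T'..T, f (pt β y) * (pt β y)⁻¹‖ ≤ A * (1 + Real.pi / d) / 2 := by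
    refine (norm_integral_mul_le hTT cr cr' (sq_nonneg A)
      ((setLIntegral_le_lintegral _ _).trans hR) hA).trans ?_
    simp only [norm_pt_inv_sq]
    have e : A ^ 2 / A = A := by field_simp
    rw [e, mul_add, mul_one]
    gcongr
    exact kv β hβ hR2
  have nl : ‖∫ y in -T'..T, f (pt α y) * (pt α y)⁻¹‖ ≤ A * (1 + Real.pi / d) / 2 := by
    refine (norm_integral_mul_le hTT cl cl' (sq_nonneg A)
      ((setLIntegral_le_lintegral _ _).trans hL) hA).trans ?_
    simp only [norm_pt_inv_sq]
    have e : A ^ 2 / A = A := by field_simp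
    rw [e, mul_add, mul_one]
    gcongr
    have := kv (-α) hα hR1
    rwa [neg_sq] at this
  -- The exact value is 2π. Half suffices: each vertical side gives at least π/2, being at least as
  -- long in both directions as it is far from 0, and the horizontal sides contribute with the right
  -- sign.
  have hre : Real.pi ≤ ((∫ x in α..β, (pt x (-T'))⁻¹) - (∫ x in α..β, (pt x T)⁻¹) +
      Complex.I * (∫ y in -T'..T, (pt β y)⁻¹) - Complex.I * (∫ y in -T'..T, (pt α y)⁻¹)).im := by
    have h1 : 0 ≤ (∫ x in α..β, (pt x (-T'))⁻¹).im := by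
      rw [im_integral ib]
      refine intervalIntegral.integral_nonneg hαβ fun x _ => ?_
      rw [pt_inv_im, neg_neg]; positivity
    have h2 : 0 ≤ -(∫ x in α..β, (pt x T)⁻¹).im := by
      rw [im_integral it, ← intervalIntegral.integral_neg]
      refine intervalIntegral.integral_nonneg hαβ fun x _ => ?_
      rw [pt_inv_im, neg_div, neg_neg]; positivity
    have h3 : Real.pi / 2 ≤ (∫ y in -T'..T, (pt β y)⁻¹).re := by
      rw [re_integral ir]
      simp only [pt_inv_re]
      exact (integral_div_sq_add_sq_mem (by linarith) (hR2.trans hT') (hR2.trans hT)).1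
    have h4 : Real.pi / 2 ≤ -(∫ y in -T'..T, (pt α y)⁻¹).re := by
      rw [re_integral il, ← intervalIntegral.integral_neg]
      simp only [pt_inv_re, ← neg_div]
      have := (integral_div_sq_add_sq_mem (b := -α) (by linarith) (hR1.trans hT')
        (hR1.trans hT)).1
      simpa only [neg_sq] using this
    simp only [Complex.sub_im, Complex.add_im, Complex.mul_im, Complex.I_re, Complex.I_im,
      zero_mul, one_mul, zero_add]
    linarith
  have hπ := hre.trans ((le_abs_self _).trans (Complex.abs_im_le_norm _))
  have heq : f 0 * ((∫ x in α..β, (pt x (-T'))⁻¹) - (∫ x in α..β, (pt x T)⁻¹) +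
      Complex.I * (∫ y in -T'..T, (pt β y)⁻¹) - Complex.I * (∫ y in -T'..T, (pt α y)⁻¹)) =
      (∫ x in α..β, f (pt x (-T')) * (pt x (-T'))⁻¹) - (∫ x in α..β, f (pt x T) * (pt x T)⁻¹) +
      Complex.I * (∫ y in -T'..T, f (pt β y) * (pt β y)⁻¹) -
      Complex.I * (∫ y in -T'..T, f (pt α y) * (pt α y)⁻¹) := by
    linear_combination (-1 : ℂ) * hrect
  have hmul := mul_le_mul_of_nonneg_left hπ (norm_nonneg (f 0))
  rw [← norm_mul, heq] at hmul
  rw [mul_comm]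
  refine hmul.trans ((norm_sub_le _ _).trans ?_)
  rw [norm_mul Complex.I, Complex.norm_I, one_mul]
  have h1 := norm_add_le ((∫ x in α..β, f (pt x (-T')) * (pt x (-T'))⁻¹) -
    (∫ x in α..β, f (pt x T) * (pt x T)⁻¹)) (Complex.I * (∫ y in -T'..T, f (pt β y) * (pt β y)⁻¹))
  rw [norm_mul Complex.I, Complex.norm_I, one_mul] at h1
  have h2 := norm_sub_le (∫ x in α..β, f (pt x (-T')) * (pt x (-T'))⁻¹)
    (∫ x in α..β, f (pt x T) * (pt x T)⁻¹)
  linarith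

lemma lintegral_line_lt_top {f : ℂ → ℂ} {b : ℝ} (hf : f ∈ hardyStrip b) :
    ∃ M : ℝ, 0 < M ∧ ∀ x ∈ Set.Ioo 0 b, ∫⁻ y, ‖f (pt x y)‖ₑ ^ 2 ≤ ENNReal.ofReal (M ^ 2) := by
  set N := ⨆ x ∈ Set.Ioo (0 : ℝ) b, ∫⁻ y : ℝ, ‖f (pt x y)‖ₑ ^ 2 with hN
  have hN1 : N < ⊤ := hf.2
  refine ⟨N.toReal + 1, by positivity, fun x hx => ?_⟩
  have h1 : ∫⁻ y, ‖f (pt x y)‖ₑ ^ 2 ≤ N :=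
    le_iSup₂ (f := fun x (_ : x ∈ Set.Ioo (0 : ℝ) b) => ∫⁻ y : ℝ, ‖f (pt x y)‖ₑ ^ 2) x hx
  refine h1.trans ?_
  rw [← ENNReal.ofReal_toReal hN1.ne]
  refine ENNReal.ofReal_le_ofReal ?_
  simp only [ENNReal.toReal_ofReal ENNReal.toReal_nonneg]
  nlinarith [ENNReal.toReal_nonneg (a := N)]

/-- Cauchy estimate in terms of the `L²` norms on two vertical lines. -/
lemma pi_mul_norm_le {f : ℂ → ℂ} {α β b d A : ℝ} {z : ℂ} (hf : DifferentiableOn ℂ f openRHP)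
    (hH : f ∈ hardyStrip b) (hα : 0 < α) (hβ : β < b) (hd : 0 < d) (hz : α + d ≤ z.re)
    (hz' : z.re + d ≤ β) (hA : 0 < A)
    (hL : ∫⁻ y, ‖f (pt α y)‖ₑ ^ 2 ≤ ENNReal.ofReal (A ^ 2))
    (hR : ∫⁻ y, ‖f (pt β y)‖ₑ ^ 2 ≤ ENNReal.ofReal (A ^ 2)) :
    Real.pi * ‖f z‖ ≤ A * (1 + Real.pi / d) := by
  have htr : ∀ x : ℝ, ∫⁻ y, ‖f (pt (x - z.re) y + z)‖ₑ ^ 2 = ∫⁻ y, ‖f (pt x y)‖ₑ ^ 2 := by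
    intro x
    rw [← lintegral_add_right_eq_self (fun y => ‖f (pt x y)‖ₑ ^ 2) z.im]
    refine lintegral_congr fun y => ?_
    congr 3
    apply Complex.ext <;> simp
  obtain ⟨M, hM, hMx⟩ := lintegral_line_lt_top hH
  have := pi_mul_norm_zero_le (f := fun w => f (w + z)) (α := α - z.re) (β := β - z.re)
    hd (by linarith) (by linarith) hA ?_ ?_ ?_ ?_
  · simpa using this
  · refine hf.comp (by fun_prop) fun w hw => ?_
    have := hw.1
    simp only [openRHP, Set.mem_ofPred_eq, Complex.add_re]
    linarith
  · exact (htr α).trans_le hL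
  · exact (htr β).trans_le hR
  · calc _ ≤ ∫⁻ x in Set.Icc (α - z.re) (β - z.re), ENNReal.ofReal (M ^ 2) := by
          refine setLIntegral_mono' measurableSet_Icc fun x hx => ?_
          have h1 := htr (x + z.re)
          rw [add_sub_cancel_right] at h1
          rw [h1]
          exact hMx _ ⟨by linarith [hx.1], by linarith [hx.2]⟩
      _ < ⊤ := by
          rw [setLIntegral_const]
          exact ENNReal.mul_lt_top ENNReal.ofReal_lt_top (by simp)

/-! ### Growth of functions in M². -/

/-- The L² norms on vertical lines are bounded uniformly in S₃, so the Cauchy estimate with the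
lines at x/2 and 2 costs only the factor 1/d = 2/x. -/
lemma exists_norm_le_div {f : ℂ → ℂ} (hf : f ∈ M2) :
    ∃ K : ℝ, 0 ≤ K ∧ ∀ x ∈ Set.Ioc (0 : ℝ) 1, ∀ y, ‖f (pt x y)‖ ≤ K / x := by
  obtain ⟨hd, hH, -, -⟩ := hf
  obtain ⟨M, hM, hMx⟩ := lintegral_line_lt_top (hH 3 (by norm_num))
  refine ⟨3 * M, by positivity, fun x hx y => ?_⟩
  have hx0 := hx.1
  have hx1 := hx.2
  have h := pi_mul_norm_le (z := pt x y) (d := x / 2) (α := x / 2) (β := 2) (A := M) hd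
    (hH 3 (by norm_num)) (by linarith) (by norm_num) (by linarith)
    (by rw [pt_re]; linarith) (by rw [pt_re]; linarith) hM
    (hMx _ ⟨by linarith, by linarith⟩) (hMx _ ⟨by norm_num, by norm_num⟩)
  have hπ := Real.pi_gt_three
  refine le_of_mul_le_mul_left (h.trans ?_) Real.pi_pos
  have e : Real.pi * (3 * M / x) = M * (Real.pi / x + Real.pi / (x / 2)) := by field_simp; ring
  rw [e]
  gcongr
  rw [le_div_iff₀ hx0]
  linarith

/-- A local maximum principle near the imaginary axis. -/
lemma norm_le_near_axis {q : ℂ → ℂ} {c K : ℝ} (hq : AnalyticOnNhd ℂ q closedRHP)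
    (hK : 0 ≤ K) (h0 : ∀ y, ‖q (pt 0 y)‖ ≤ c)
    (h1 : ∀ x ∈ Set.Ioc (0 : ℝ) 1, ∀ y, ‖q (pt x y)‖ ≤ K / x) {x y : ℝ}
    (hx : x ∈ Set.Icc (0 : ℝ) 1) : ‖q (pt x y)‖ ≤ 9 * (c + K) := by
  have hc : 0 ≤ c := (norm_nonneg _).trans (h0 0)
  set U : Set ℂ := Set.Ioo (0 : ℝ) 1 ×ℂ Set.Ioo (y - 1) (y + 1) with hU
  have hyy : y - 1 ≠ y + 1 := by linarith
  have hcl : closure U = Set.Icc (0 : ℝ) 1 ×ℂ Set.Icc (y - 1) (y + 1) := by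
    rw [hU, Complex.closure_reProdIm, closure_Ioo zero_ne_one, closure_Ioo hyy]
  have hclosed : closure U ⊆ closedRHP := by
    rw [hcl]; exact fun w hw => hw.1.1
  -- The quadratic factor vanishes at the two corners of the box on the axis. On a horizontal edge
  -- one of its factors has modulus Re w and cancels the blow-up K / Re w; at the point to be
  -- estimated both have modulus at least 1.
  set F : ℂ → ℂ := fun w => q w * ((w - pt 0 (y - 1)) * (w - pt 0 (y + 1))) with hF
  have hFd : DiffContOnCl ℂ F U := by
    refine DifferentiableOn.diffContOnCl ?_
    exact (hq.differentiableOn.mono hclosed).mul (by fun_prop)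
  have hfac : ∀ w ∈ closure U, ∀ s, |w.im - s| ≤ 2 → ‖w - pt 0 s‖ ≤ 3 := by
    intro w hw s hs
    rw [hcl] at hw
    refine (Complex.norm_le_abs_re_add_abs_im _).trans ?_
    have : |w.re| ≤ 1 := by rw [abs_of_nonneg hw.1.1]; exact hw.1.2
    simp only [Complex.sub_re, Complex.sub_im, pt_re, pt_im, sub_zero]
    linarith
  have hfr : ∀ w ∈ frontier U, ‖F w‖ ≤ 9 * (c + K) := by
    intro w hw
    have hwc : w ∈ closure U := frontier_subset_closure hw
    have hwc' := hwc
    rw [hcl] at hwc'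
    obtain ⟨⟨hr0, hr1⟩, hi0, hi1⟩ := hwc'
    have ha := hfac w hwc (y - 1) (by rw [abs_le]; constructor <;> linarith)
    have hb := hfac w hwc (y + 1) (by rw [abs_le]; constructor <;> linarith)
    have hwpt : q w = q (pt w.re w.im) := by rw [pt_re_im]
    rw [hF]
    simp only [norm_mul]
    rw [hU, Complex.frontier_reProdIm, frontier_Ioo (by linarith), frontier_Ioo zero_lt_one] at hw
    have hedge : ∀ s, w.im = s → ‖q w‖ * ‖w - pt 0 s‖ ≤ K := by
      intro s hs
      have e : w - pt 0 s = (w.re : ℂ) := by apply Complex.ext <;> simp [hs]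
      rw [e, Complex.norm_real, Real.norm_of_nonneg hr0]
      rcases hr0.eq_or_lt with h | h
      · rw [← h, mul_zero]; exact hK
      · rw [← le_div_iff₀ h, hwpt]
        exact h1 _ ⟨h, hr1⟩ _
    rcases hw with ⟨-, hw | hw⟩ | ⟨hw | hw, -⟩
    · have := hedge _ hw
      rw [← mul_assoc]
      calc _ ≤ K * 3 := by gcongr
        _ ≤ _ := by linarith
    · have := hedge _ hw
      rw [mul_comm ‖w - pt 0 (y - 1)‖, ← mul_assoc]
      calc _ ≤ K * 3 := by gcongr
        _ ≤ _ := by linarith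
    · have : ‖q w‖ ≤ c := by
        rw [hwpt, show w.re = 0 from hw]; exact h0 _
      calc _ ≤ c * (3 * 3) := by gcongr
        _ ≤ _ := by linarith
    · have : ‖q w‖ ≤ K := by
        rw [hwpt, show w.re = 1 from hw]; simpa using h1 1 (by simp) w.im
      calc _ ≤ K * (3 * 3) := by gcongr
        _ ≤ _ := by linarith
  have hmem : pt x y ∈ closure U := by
    rw [hcl, Complex.mem_reProdIm, pt_re, pt_im]
    exact ⟨hx, by constructor <;> linarith⟩
  have hbd : Bornology.IsBounded U :=
    (Metric.isBounded_Ioo _ _).reProdIm (Metric.isBounded_Ioo _ _)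
  have hmax := Complex.norm_le_of_forall_mem_frontier_norm_le hbd hFd hfr hmem
  refine le_trans ?_ hmax
  rw [hF]
  simp only [norm_mul]
  have h2 : 1 ≤ ‖pt x y - pt 0 (y - 1)‖ :=
    le_trans (by simp) (Complex.abs_im_le_norm _)
  have h3 : 1 ≤ ‖pt x y - pt 0 (y + 1)‖ :=
    le_trans (by simp) (Complex.abs_im_le_norm _)
  exact le_mul_of_one_le_right (norm_nonneg _) (one_le_mul_of_one_le_of_one_le h2 h3)

lemma exists_lintegral_line_le {f : ℂ → ℂ} (hf : f ∈ M2) (hfc : f ∈ holClosed) :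
    ∃ S : ℝ, 1 ≤ S ∧ ∀ n : ℕ, ∫⁻ y : ℝ, ‖f (pt ((n : ℝ) / 2) y)‖ₑ ^ 2 ≤
      ENNReal.ofReal (S * (n.factorial / 2 ^ n)) := by
  have hmem := (memLp_omega_iff hfc.continuousOn).1 hf.2.2.2
  set N := ∑' n : ℕ, ENNReal.ofReal ((2 : ℝ) ^ n / (n.factorial : ℝ)) *
      ∫⁻ y : ℝ, ‖f (pt ((n : ℝ) / 2) y)‖ₑ ^ 2 with hN
  refine ⟨N.toReal + 1, by linarith [ENNReal.toReal_nonneg (a := N)], fun n => ?_⟩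
  have h1 : ENNReal.ofReal ((2 : ℝ) ^ n / (n.factorial : ℝ)) *
      ∫⁻ y : ℝ, ‖f (pt ((n : ℝ) / 2) y)‖ₑ ^ 2 ≤ ENNReal.ofReal (N.toReal + 1) := by
    refine (ENNReal.le_tsum (f := fun n : ℕ => ENNReal.ofReal ((2 : ℝ) ^ n / (n.factorial : ℝ)) *
      ∫⁻ y : ℝ, ‖f (pt ((n : ℝ) / 2) y)‖ₑ ^ 2) n).trans ?_
    rw [← hN]
    conv_lhs => rw [← ENNReal.ofReal_toReal hmem.ne]
    exact ENNReal.ofReal_le_ofReal (by linarith)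
  have h2 : ENNReal.ofReal ((n.factorial : ℝ) / 2 ^ n) *
      ENNReal.ofReal ((2 : ℝ) ^ n / (n.factorial : ℝ)) = 1 := by
    rw [← ENNReal.ofReal_mul (by positivity), ← ENNReal.ofReal_one]
    congr 1
    field_simp
  calc _ = ENNReal.ofReal ((n.factorial : ℝ) / 2 ^ n) *
        (ENNReal.ofReal ((2 : ℝ) ^ n / (n.factorial : ℝ)) *
          ∫⁻ y : ℝ, ‖f (pt ((n : ℝ) / 2) y)‖ₑ ^ 2) := by rw [← mul_assoc, h2, one_mul]
    _ ≤ ENNReal.ofReal ((n.factorial : ℝ) / 2 ^ n) * ENNReal.ofReal (N.toReal + 1) := by gcongr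
    _ = _ := by
      rw [← ENNReal.ofReal_mul (by positivity), mul_comm]

/-- The core is (k+1)! ≤ (k+1)^{k+1} ≤ (2x)^{k+1}, where 2^{k+1} cancels against 2^k and x^{k+1} ≤
x^{2x}. The further factors of (k+3)! go into (1+x)². -/
lemma factorial_div_two_pow_le {x : ℝ} {k n : ℕ} (hk : (k + 1 : ℝ) ≤ 2 * x) (hx : 1 ≤ x)
    (hn : n = k ∨ n = k + 3) :
    (n.factorial : ℝ) / 2 ^ n ≤ 9 * ((1 + x) * Real.exp (x * Real.log x)) ^ 2 := by
  have hx0 : 0 < x := by linarith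
  have h1 : (n.factorial : ℝ) / 2 ^ n ≤ (k + 3).factorial / 2 ^ k := by
    have h2 : (n.factorial : ℝ) ≤ (k + 3).factorial := by
      exact_mod_cast Nat.factorial_le (by omega)
    have h3 : (2 : ℝ) ^ k ≤ 2 ^ n := pow_le_pow_right₀ (by norm_num) (by omega)
    gcongr
  have h4 : ((k + 3).factorial : ℝ) ≤ (k + 3) * (k + 2) * (k + 1) ^ (k + 1) := by
    have h5 : ((k + 1).factorial : ℝ) ≤ (k + 1) ^ (k + 1) := by
      exact_mod_cast Nat.factorial_le_pow (k + 1)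
    rw [Nat.factorial_succ (k + 2), Nat.factorial_succ (k + 1)]
    push_cast
    rw [← mul_assoc, show ((k : ℝ) + 2 + 1) = k + 3 by ring, show ((k : ℝ) + 1 + 1) = k + 2 by ring]
    gcongr
  have h6 : ((k : ℝ) + 1) ^ (k + 1) ≤ 2 ^ (k + 1) * Real.exp (x * Real.log x) ^ 2 := by
    calc ((k : ℝ) + 1) ^ (k + 1) ≤ (2 * x) ^ (k + 1) := by gcongr
      _ = 2 ^ (k + 1) * Real.exp ((k + 1 : ℕ) * Real.log x) := by
          rw [mul_pow, Real.exp_nat_mul, Real.exp_log hx0]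
      _ ≤ 2 ^ (k + 1) * Real.exp (2 * x * Real.log x) := by
          have := Real.log_nonneg hx
          gcongr
          exact_mod_cast hk
      _ = _ := by rw [← Real.exp_nat_mul]; push_cast; ring_nf
  calc _ ≤ _ := h1
    _ ≤ (k + 3) * (k + 2) * (2 ^ (k + 1) * Real.exp (x * Real.log x) ^ 2) / 2 ^ k := by
        gcongr; exact h4.trans (by gcongr)
    _ = 2 * ((k + 3) * (k + 2)) * Real.exp (x * Real.log x) ^ 2 := by
        rw [pow_succ]; field_simp
    _ ≤ 9 * (1 + x) ^ 2 * Real.exp (x * Real.log x) ^ 2 := by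
        have h7 : 2 * (((k : ℝ) + 3) * (k + 2)) ≤ 9 * (1 + x) ^ 2 := by nlinarith
        exact mul_le_mul_of_nonneg_right h7 (sq_nonneg _)
    _ = _ := by ring

lemma exists_norm_le_exp_mul_log {f : ℂ → ℂ} (hf : f ∈ M2) (hfc : f ∈ holClosed) :
    ∃ C : ℝ, 0 ≤ C ∧ ∀ x : ℝ, 1 ≤ x → ∀ y,
      ‖f (pt x y)‖ ≤ C * ((1 + x) * Real.exp (x * Real.log x)) := by
  obtain ⟨S, hS, hSn⟩ := exists_lintegral_line_le hf hfc
  refine ⟨9 * S, by linarith, fun x hx y => ?_⟩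
  -- The lines k/2 and (k+3)/2 enclose x at distance at least 1/2, and k ≥ 1 keeps the left one off
  -- the axis.
  obtain ⟨k, hk0, hk1, hk2⟩ : ∃ k : ℕ, 1 ≤ k ∧ (k + 1 : ℝ) ≤ 2 * x ∧ 2 * x ≤ k + 2 := by
    have h1 : 2 ≤ ⌊2 * x⌋₊ := Nat.le_floor (by push_cast; linarith)
    have h2 := Nat.floor_le (by linarith : 0 ≤ 2 * x)
    have h3 := Nat.lt_floor_add_one (2 * x)
    obtain ⟨k, hk⟩ := Nat.exists_eq_add_of_le h1
    rw [hk] at h2 h3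
    push_cast at h2 h3
    exact ⟨k + 1, by omega, by push_cast; linarith, by push_cast; linarith⟩
  have hk0' : (1 : ℝ) ≤ k := by exact_mod_cast hk0
  set G := (1 + x) * Real.exp (x * Real.log x) with hG
  have hG0 : 0 < G := by positivity
  have hline : ∀ n : ℕ, n = k ∨ n = k + 3 →
      ∫⁻ y : ℝ, ‖f (pt ((n : ℝ) / 2) y)‖ₑ ^ 2 ≤ ENNReal.ofReal ((3 * S * G) ^ 2) := by
    intro n hn
    refine (hSn n).trans (ENNReal.ofReal_le_ofReal ?_)
    calc _ ≤ S * (9 * G ^ 2) := by gcongr; exact factorial_div_two_pow_le hk1 hx hn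
      _ ≤ S ^ 2 * (9 * G ^ 2) := by gcongr; nlinarith
      _ = _ := by ring
  have h := pi_mul_norm_le (z := pt x y) (d := 1 / 2) (b := (k + 3 : ℕ) / 2 + 1) (A := 3 * S * G)
    hf.1 (hf.2.1 _ (by positivity)) (by positivity) (by linarith) (by norm_num)
    (by rw [pt_re]; linarith) (by rw [pt_re]; push_cast; linarith) (by positivity)
    (hline k (Or.inl rfl)) (hline (k + 3) (Or.inr rfl))
  have hπ := Real.pi_gt_three
  refine le_of_mul_le_mul_left (h.trans ?_) Real.pi_pos
  have h5 : 1 + Real.pi / (1 / 2) ≤ 3 * Real.pi := by linarith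
  calc _ ≤ 3 * S * G * (3 * Real.pi) := by gcongr
    _ = _ := by ring

/-! ### The second inclusion. -/

theorem zeroSets_M2_subset :
    zeroSets (M2 ∩ holClosed) ⊆ zeroSets (expType (Real.pi / 2)) := by
  refine zeroSets_subset_of_mul_exp Set.inter_subset_right ?_
  rintro f ⟨hf, hfc⟩
  set u : ℝ → ℝ := fun y => ‖f (pt 0 y)‖ ^ 2 with hu
  have huc : Continuous u := (ContinuousOn.comp_continuous (AnalyticOnNhd.continuousOn hfc)
    (continuous_pt_right 0) fun y => pt_mem_closedRHP le_rfl y).norm.pow 2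
  have hui : Integrable u := by
    obtain ⟨S, -, hSn⟩ := exists_lintegral_line_le hf hfc
    refine ⟨huc.aestronglyMeasurable, ?_⟩
    refine lt_of_le_of_lt (le_of_eq ?_) ((hSn 0).trans_lt ENNReal.ofReal_lt_top)
    refine lintegral_congr fun y => ?_
    simp [hu, enorm_pow]
  obtain ⟨H, hH, hH0, hHu⟩ := exists_re_dominating huc (fun y => by positivity) hui
  have hE : AnalyticOnNhd ℂ (fun z => -(z * Complex.log (1 + z)) - H z) closedRHP :=
    analyticOnNhd_mul_log.neg.sub hH
  refine ⟨_, hE, AnalyticOnNhd.mul hfc hE.cexp, fun ε hε => ?_⟩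
  obtain ⟨K, hK, hfK⟩ := exists_norm_le_div hf
  obtain ⟨C, hC, hfC⟩ := exists_norm_le_exp_mul_log hf hfc
  have hq1 : ∀ z ∈ closedRHP, ‖f z * Complex.exp (-H z)‖ ≤ ‖f z‖ := fun z hz => by
    rw [norm_mul, Complex.norm_exp, Complex.neg_re]
    exact mul_le_of_le_one_right (norm_nonneg _) (Real.exp_le_one_iff.2 (by linarith [hH0 z hz]))
  -- Since |f| ≤ e^{|f|²}, the integrable function |f|² can stand in for log|f|; the loss of 1 in Re
  -- H ≥ |f|² - 1 becomes the constant e.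
  have hq0 : ∀ y, ‖f (pt 0 y) * Complex.exp (-H (pt 0 y))‖ ≤ Real.exp 1 := fun y => by
    rw [norm_mul, Complex.norm_exp, Complex.neg_re]
    have h1 : ‖f (pt 0 y)‖ ≤ Real.exp (u y) := by
      have := Real.add_one_le_exp (u y)
      have h2 : u y = ‖f (pt 0 y)‖ ^ 2 := rfl
      nlinarith [sq_nonneg (‖f (pt 0 y)‖ - 1)]
    calc _ ≤ Real.exp (u y) * Real.exp (-(H (pt 0 y)).re) := by gcongr
      _ ≤ _ := by
        rw [← Real.exp_add]
        exact Real.exp_le_exp.2 (by linarith [hHu y])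
  have hnear : ∀ x ∈ Set.Icc (0 : ℝ) 1, ∀ y,
      ‖f (pt x y) * Complex.exp (-H (pt x y))‖ ≤ 9 * (Real.exp 1 + K) := fun x hx y =>
    norm_le_near_axis (q := fun z => f z * Complex.exp (-H z)) (AnalyticOnNhd.mul hfc hH.neg.cexp)
      hK hq0 (fun x hx y => (hq1 _ (pt_mem_closedRHP hx.1.le y)).trans (hfK x hx y)) hx
  refine ⟨9 * (Real.exp 1 + K) + C * (1 + 1 / ε), fun z hz => ?_⟩
  have hx : 0 ≤ z.re := hz
  have hsplit : f z * Complex.exp (-(z * Complex.log (1 + z)) - H z) =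
      f z * Complex.exp (-H z) * Complex.exp (-(z * Complex.log (1 + z))) := by
    rw [mul_assoc, ← Complex.exp_add]; congr 2; ring
  have harg : z.im * Complex.arg (1 + z) ≤ Real.pi / 2 * |z.im| := by
    have := im_mul_arg_le (w := 1 + z) (by simp only [Complex.add_re, Complex.one_re]; linarith)
    simpa using this
  have hn : 1 + z.re ≤ ‖1 + z‖ := by simpa using Complex.re_le_norm (1 + z)
  have hzr := Complex.re_le_norm z
  have hzi := Complex.abs_im_le_norm z
  have hzim : Real.pi / 2 * |z.im| ≤ Real.pi / 2 * ‖z‖ := by gcongr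
  change ‖f z * Complex.exp (-(z * Complex.log (1 + z)) - H z)‖ ≤ _
  change ‖f z * Complex.exp (-(z * Complex.log (1 + z)) - H z)‖ ≤ _
  rw [hsplit, norm_mul, Complex.norm_exp (-(z * _)), Complex.neg_re, re_mul_log]
  have hCε : 0 ≤ C * (1 + 1 / ε) := by positivity
  -- For Re z ≤ 1 the bounded product f exp(-H) is used. Beyond that, x^x is cancelled by |1+z|^x,
  -- and the remaining factor 1 + x goes into e^{ε|z|}, so the type is π/2 but the constant depends
  -- on ε.
  rcases le_total z.re 1 with h | h
  · have h1 := hnear z.re ⟨hx, h⟩ z.im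
    rw [pt_re_im] at h1
    have h2 : 0 ≤ z.re * Real.log ‖1 + z‖ := mul_nonneg hx (Real.log_nonneg (by linarith))
    calc _ ≤ 9 * (Real.exp 1 + K) * Real.exp ((Real.pi / 2 + ε) * ‖z‖) := by
          refine mul_le_mul h1 (Real.exp_le_exp.2 ?_) (Real.exp_pos _).le (by positivity)
          have := mul_nonneg hε.le (norm_nonneg z)
          linarith
      _ ≤ _ := by gcongr; linarith
  · have h1 := (hq1 z hz).trans (by simpa [pt_re_im] using hfC z.re h z.im)
    have h2 : z.re * Real.log z.re ≤ z.re * Real.log ‖1 + z‖ := by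
      gcongr
      linarith
    have h3 : 1 + z.re ≤ (1 + 1 / ε) * Real.exp (ε * ‖z‖) := by
      have h4 := Real.add_one_le_exp (ε * ‖z‖)
      have h5 : (1 + 1 / ε) * (ε * z.re + 1) = 1 + z.re + (ε * z.re + 1 / ε) := by
        field_simp; ring
      have h6 : 0 ≤ ε * z.re + 1 / ε := by positivity
      calc 1 + z.re ≤ (1 + 1 / ε) * (ε * z.re + 1) := by linarith
        _ ≤ (1 + 1 / ε) * (ε * ‖z‖ + 1) := by gcongr
        _ ≤ _ := by gcongr
    calc _ ≤ C * ((1 + z.re) * Real.exp (z.re * Real.log z.re)) *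
          Real.exp (-(z.re * Real.log ‖1 + z‖ - z.im * Complex.arg (1 + z))) := by gcongr
      _ = C * (1 + z.re) * Real.exp (z.re * Real.log z.re +
          -(z.re * Real.log ‖1 + z‖ - z.im * Complex.arg (1 + z))) := by
          rw [Real.exp_add]; ring
      _ ≤ C * ((1 + 1 / ε) * Real.exp (ε * ‖z‖)) * Real.exp (Real.pi / 2 * ‖z‖) := by
          refine mul_le_mul (by gcongr) (Real.exp_le_exp.2 (by linarith)) (Real.exp_pos _).le
            (by positivity)
      _ = C * (1 + 1 / ε) * Real.exp ((Real.pi / 2 + ε) * ‖z‖) := by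
          rw [add_mul (Real.pi / 2), Real.exp_add]; ring
      _ ≤ _ := by gcongr; have := Real.exp_pos 1; linarith

end HalfPlane
end

theorem mainTheorem11 :
    HalfPlane.zeroSets (HalfPlane.expTypeLT (Real.pi / 2)) ⊆
        HalfPlane.zeroSets (HalfPlane.M2 ∩ HalfPlane.holClosed) ∧
      HalfPlane.zeroSets (HalfPlane.M2 ∩ HalfPlane.holClosed) ⊆
        HalfPlane.zeroSets (HalfPlane.expType (Real.pi / 2)) :=
  ⟨HalfPlane.zeroSets_expTypeLT_subset, HalfPlane.zeroSets_M2_subset⟩
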